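/- All spaces are metric. A continuum is a nonempty compact connected metric space, and an arc is a space homeomorphic to $[0,1]$. A dendroid is a continuum $X$ that is arcwise connected and hereditarily unicoherent (whenever $A$, $B$ and $A\cup B$ are subcontinua of $X$, the intersection $A\cap B$ is connected). In a dendroid, $pq$ denotes the unique arc with endpoints $p\neq q$, and $pp=\{p\}$. The order of a point $p$ is the largest number of arcs in $X$ having $p$ as a common endpoint and pairwise disjoint except for $p$; $p$ is an endpoint if its order is $1$ and a ramification point if its order is greater than $2$. $E(X)$ denotes the set of endpoints. A fan is a dendroid with exactly one ramification point, called its top. The homogeneity degree of $X$ is the number of orbits of the action on $X$ of the group of homeomorphisms of $X$ onto itself. A dendroid $X$ is smooth if there is $p\in X$ such that whenever $a_n\to a$ in $X$, the arcs $pa_n$ converge to $pa$ in the Hausdorff metric. For a fan $X$ with top $t$, let $$S(X)=\{a\in X : \text{for every sequence } a_n\to a \text{ in } X,\ ta_n\to ta \text{ in the Hausdorff metric}\}.$$ $X$ is colocally connected at a point $p$ if every neighborhood of $p$ contains a neighborhood $V$ of $p$ such that $X\setminus V$ is connected. **Theorem.** Let $X$ be a fan with top $t$ that is not smooth and has homogeneity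 degree $3$. Then: 1. $X$ is colocally connected at each point of $E(X)$; 2. $E(X)$ is dense in $X$; and 3. $S(X)=E(X)\cup\{t\}$. -/

import Mathlib

open Set Filter Topology

namespace FanTheory

section

variable {X : Type*} [TopologicalSpace X]

/-- `A` is an arc (a homeomorphic copy of `[0,1]`) in `X` with endpoints `p` and `q`. -/
def IsArc (A : Set X) (p q : X) : Prop :=
  ∃ f : unitInterval → X, IsEmbedding f ∧ f 0 = p ∧ f 1 = q ∧ range f = A

/-- A subcontinuum of `X` (for `X` a metric space): a nonempty compact connected subset. -/
def IsSubcontinuum (K : Set X) : Prop :=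
  IsCompact K ∧ IsConnected K

/-- The continuum `K` is unicoherent: whenever it is the union of two subcontinua, their
intersection is connected. -/
def IsUnicoherent (K : Set X) : Prop :=
  ∀ A B : Set X, IsSubcontinuum A → IsSubcontinuum B → A ∪ B = K → IsConnected (A ∩ B)

variable (X) in
/-- A dendroid is an arcwise connected and hereditarily unicoherent continuum. (The theory is
applied to metric spaces `X`.) -/
structure IsDendroid : Prop where
  isSubcontinuum_univ : IsSubcontinuum (univ : Set X)
  arcwiseConnected : ∀ p q : X, p ≠ q → ∃ A : Set X, IsArc A p q
  hereditarilyUnicoherent : ∀ K : Set X, IsSubcontinuum K → IsUnicoherent K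

/-- The arc `pq` in a dendroid, with `pp = {p}`. In a dendroid there is exactly one arc with
endpoints `p ≠ q`, and `arc p q` is that arc; see `IsDendroid.arc_eq`. -/
def arc (p q : X) : Set X :=
  {p, q} ∪ ⋃₀ {A : Set X | IsArc A p q}

/-- A family of arcs in `X`, each of which has `p` as one of its endpoints, that are disjoint from
one another beyond `p`. -/
def IsArcFamilyAt (p : X) (S : Set (Set X)) : Prop :=
  (∀ A ∈ S, ∃ q : X, IsArc A p q) ∧ S.Pairwise fun A B => A ∩ B = {p}

/-- The order of a point in the classical sense: the largest number of arcs which have `p` as a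
common endpoint and are disjoint from one another beyond `p`. All infinite orders are identified
with `⊤`; the order is only ever compared with `1` and `2`. -/
noncomputable def ord (p : X) : ℕ∞ :=
  ⨆ (S : Set (Set X)) (_ : IsArcFamilyAt p S), S.encard

variable (X) in
/-- The set `E(X)` of endpoints. -/
def endpoints : Set X := {p | ord p = 1}

variable (X) in
/-- The set `R(X)` of ramification points. -/
def ramificationPoints : Set X := {p | 2 < ord p}

variable (X) in
/-- A fan is a dendroid with exactly one ramification point. -/
def IsFan : Prop :=
  IsDendroid X ∧ ∃! t : X, t ∈ ramificationPoints X

/-- The orbit of `x` under the group of homeomorphisms of `X` onto itself. -/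
def homeoOrbit (x : X) : Set X :=
  {y | ∃ h : X ≃ₜ X, h x = y}

variable (X) in
/-- The number of orbits for the action of the homeomorphism group of `X` on `X`. -/
noncomputable def homogeneityDegree : ℕ∞ :=
  (range (homeoOrbit : X → Set X)).encard

/-- `X` is colocally connected at `p`: each neighborhood of `p` contains a neighborhood of `p`
whose complement is connected. -/
def IsColocallyConnectedAt (p : X) : Prop :=
  ∀ U ∈ 𝓝 p, ∃ V ∈ 𝓝 p, V ⊆ U ∧ IsConnected Vᶜ

/-- A subset of an arc that is connected and contains both endpoints is the whole arc. -/
theorem IsArc.eq_of_subset {A C : Set X} {p q : X} (hA : IsArc A p q) (hCA : C ⊆ A)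
    (hC : IsPreconnected C) (hp : p ∈ C) (hq : q ∈ C) : C = A := by
  obtain ⟨f, hf, rfl, rfl, rfl⟩ := hA
  have h1 : IsPreconnected (f ⁻¹' C) := by
    rw [← hf.isInducing.isPreconnected_image, image_preimage_eq_of_subset hCA]
    exact hC
  have h2 : (f ⁻¹' C) = univ := by
    apply eq_univ_of_forall
    intro x
    exact h1.ordConnected.out (x := 0) (y := 1) hp hq ⟨x.2.1, x.2.2⟩
  apply hCA.antisymm
  rintro _ ⟨x, rfl⟩
  have : x ∈ f ⁻¹' C := h2 ▸ mem_univ x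
  exact this

theorem IsArc.isSubcontinuum {A : Set X} {p q : X} (hA : IsArc A p q) : IsSubcontinuum A := by
  obtain ⟨f, hf, -, -, rfl⟩ := hA
  exact ⟨isCompact_range hf.continuous, isConnected_range hf.continuous⟩

theorem IsArc.left_mem {A : Set X} {p q : X} (hA : IsArc A p q) : p ∈ A := by
  obtain ⟨f, -, rfl, -, rfl⟩ := hA
  exact mem_range_self _

theorem IsArc.right_mem {A : Set X} {p q : X} (hA : IsArc A p q) : q ∈ A := by
  obtain ⟨f, -, -, rfl, rfl⟩ := hA
  exact mem_range_self _

theorem IsArc.ne {A : Set X} {p q : X} (hA : IsArc A p q) : p ≠ q := by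
  obtain ⟨f, hf, rfl, rfl, -⟩ := hA
  exact fun h => zero_ne_one (hf.injective h)

/-- In a dendroid, the arc joining two points is unique. -/
theorem IsDendroid.isArc_unique (hX : IsDendroid X) {A B : Set X} {p q : X}
    (hA : IsArc A p q) (hB : IsArc B p q) : A = B := by
  have hK : IsSubcontinuum (A ∪ B) :=
    ⟨hA.isSubcontinuum.1.union hB.isSubcontinuum.1,
      hA.isSubcontinuum.2.union ⟨p, hA.left_mem, hB.left_mem⟩ hB.isSubcontinuum.2⟩
  have hc := (hX.hereditarilyUnicoherent _ hK A B hA.isSubcontinuum hB.isSubcontinuum rfl).2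
  have h1 := hA.eq_of_subset inter_subset_left hc ⟨hA.left_mem, hB.left_mem⟩
    ⟨hA.right_mem, hB.right_mem⟩
  have h2 := hB.eq_of_subset inter_subset_right hc ⟨hA.left_mem, hB.left_mem⟩
    ⟨hA.right_mem, hB.right_mem⟩
  exact h1.symm.trans h2

theorem IsDendroid.arc_eq (hX : IsDendroid X) {A : Set X} {p q : X} (hA : IsArc A p q) :
    arc p q = A := by
  have h : {B : Set X | IsArc B p q} = {A} := by
    ext B
    exact ⟨fun hB => hX.isArc_unique hB hA, fun hB => by rw [mem_singleton_iff.1 hB]; exact hA⟩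
  rw [arc, h, sUnion_singleton, union_eq_right]
  rintro x (rfl | rfl)
  exacts [hA.left_mem, hA.right_mem]

theorem arc_self (p : X) : arc p p = {p} := by
  have h : {B : Set X | IsArc B p p} = ∅ := eq_empty_of_forall_notMem fun B hB => hB.ne rfl
  rw [arc, h]
  simp

end

section

variable {X : Type*} [MetricSpace X]

/-- `X` is smooth at `p` with respect to `a`: for every sequence `aₙ → a`, the arcs `paₙ` converge
to the arc `pa` in the Hausdorff metric. -/
def IsSmoothAtWrt (p a : X) : Prop :=
  ∀ u : ℕ → X, Tendsto u atTop (𝓝 a) →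
    Tendsto (fun n => Metric.hausdorffEDist (arc p (u n)) (arc p a)) atTop (𝓝 0)

variable (X) in
/-- The dendroid `X` is smooth: there is a point `p` such that `aₙ → a` always implies that the
arcs `paₙ` converge to the arc `pa`. -/
def IsSmooth : Prop :=
  ∃ p : X, ∀ a : X, IsSmoothAtWrt p a

/-- The set `S(X)`, for a fan `X` with top `t`, of the points `a` such that `X` is smooth at `t`
with respect to `a`. -/
def smoothnessSet (t : X) : Set X := {a | IsSmoothAtWrt t a}

end

end FanTheory

/-!
Fix the top `t` of the fan `X` and order `X` by `x ≤ y ↔ x ∈ arc t y`. In a dendroid the arc `pq` is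
the least subcontinuum containing `p` and `q`, and nearly everything about arcs follows from this.
In the fan two points are comparable or lie on legs meeting only in `t`, and the endpoints are the
maximal points. Every increasing union of arcs from `t` is contained in an arc
(`IsFan.exists_upper_bound`, a Baire category argument), so every point other than `t` lies below an
endpoint.
Homogeneity degree `3` then says that the orbits are `{t}`, `E(X)` and the set of remaining,
ordinary, points.

For a set `U`, let `beyond t U` be the set of points `x` whose arc `tx` meets `U`; it is open if `U`
is. Let `upperLimit t y` be the upper limit of the arcs `tz` as `z → y`, which contains `ty`;
smoothness at `t` with respect to `y` means that it equals `ty`. The key fact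
(`IsDendroid.mem_upperLimit_of_mem_arc`) is that `b ∈ upperLimit t a` implies
`b ∈ upperLimit t c` for all `c` in the arc `ab`: arcs ending near `a` that have passed near `b`
must come back along `ab`.

*Colocal connectedness.* At an endpoint `e` it follows once `e ∈ upperLimit t x` forces `x = e`.
If this fails, the key fact gives an ordinary point `c` of the leg `te` with `e ∈ upperLimit t c`,
and homogeneity gives the same for all points of all legs. Hence `beyond t U` accumulates on the
whole arc `tx` for every open `U` and every `x ∈ beyond t U`. So arcs that leave an open set, come
near `t` and return to that set always exist, and by the Baire category theorem some arc would
oscillate infinitely often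
(`IsDendroid.exists_not_arc_subset_closure_beyond`).

*Density and smoothness.* Since `X` is not smooth, the key fact produces an ordinary point outside
`S(X)`, and by homogeneity no ordinary point is in `S(X)`. But `S(X)` is residual, because
`x ↦ tx` is lower semicontinuous, so it meets `E(X)`; by homogeneity `E(X) ⊆ S(X)`, and density of
`S(X)` gives density of `E(X)`. Finally `t ∈ S(X)`: otherwise `upperLimit t t` contains an ordinary
point, hence all of them, hence an endpoint, contrary to the first part.
-/

namespace FanTheory

/-! ### Arcs in dendroids -/

section Arcs

variable {X : Type*} [MetricSpace X] {t p q r x y c e : X}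

theorem IsArc.symm {A : Set X} (hA : IsArc A p q) : IsArc A q p := by
  obtain ⟨f, hf, h0, h1, hr⟩ := hA
  refine ⟨f ∘ unitInterval.symm, hf.comp unitInterval.symmHomeomorph.isEmbedding, ?_, ?_, ?_⟩
  · simpa using h1
  · simpa using h0
  · rw [← hr]
    exact unitInterval.symmHomeomorph.surjective.range_comp f

theorem left_mem_arc (p q : X) : p ∈ arc p q := Or.inl (Or.inl rfl)

theorem right_mem_arc (p q : X) : q ∈ arc p q := Or.inl (Or.inr rfl)

theorem IsDendroid.compactSpace (hX : IsDendroid X) : CompactSpace X :=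
  ⟨hX.isSubcontinuum_univ.1⟩

theorem IsDendroid.isArc_arc (hX : IsDendroid X) (h : p ≠ q) : IsArc (arc p q) p q := by
  obtain ⟨A, hA⟩ := hX.arcwiseConnected p q h
  rwa [hX.arc_eq hA]

theorem IsDendroid.isSubcontinuum_arc (hX : IsDendroid X) (p q : X) :
    IsSubcontinuum (arc p q) := by
  rcases eq_or_ne p q with rfl | h
  · rw [arc_self]
    exact ⟨isCompact_singleton, isConnected_singleton⟩
  · exact (hX.isArc_arc h).isSubcontinuum

theorem IsDendroid.isClosed_arc (hX : IsDendroid X) (p q : X) : IsClosed (arc p q) :=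
  (hX.isSubcontinuum_arc p q).1.isClosed

theorem IsSubcontinuum.union {K L : Set X} (hK : IsSubcontinuum K) (hL : IsSubcontinuum L)
    (h : (K ∩ L).Nonempty) : IsSubcontinuum (K ∪ L) :=
  ⟨hK.1.union hL.1, hK.2.union h hL.2⟩

theorem IsDendroid.isConnected_inter (hX : IsDendroid X) {K L : Set X} (hK : IsSubcontinuum K)
    (hL : IsSubcontinuum L) (h : (K ∩ L).Nonempty) : IsConnected (K ∩ L) :=
  hX.hereditarilyUnicoherent _ (hK.union hL h) K L hK hL rfl

/-- In a dendroid, the arc `pq` is the least subcontinuum containing `p` and `q`. -/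
theorem IsDendroid.arc_subset (hX : IsDendroid X) {K : Set X} (hK : IsSubcontinuum K)
    (hp : p ∈ K) (hq : q ∈ K) : arc p q ⊆ K := by
  rcases eq_or_ne p q with rfl | h
  · rw [arc_self]
    exact singleton_subset_iff.2 hp
  · have hA := hX.isArc_arc h
    have hc := hX.isConnected_inter hA.isSubcontinuum hK ⟨p, hA.left_mem, hp⟩
    rw [← inter_eq_left]
    exact hA.eq_of_subset inter_subset_left hc.2 ⟨hA.left_mem, hp⟩ ⟨hA.right_mem, hq⟩

theorem IsDendroid.arc_comm (hX : IsDendroid X) (p q : X) : arc p q = arc q p :=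
  (hX.arc_subset (hX.isSubcontinuum_arc q p) (right_mem_arc _ _) (left_mem_arc _ _)).antisymm
    (hX.arc_subset (hX.isSubcontinuum_arc p q) (right_mem_arc _ _) (left_mem_arc _ _))

theorem IsDendroid.arc_subset_arc_left (hX : IsDendroid X) (h : x ∈ arc p q) :
    arc p x ⊆ arc p q :=
  hX.arc_subset (hX.isSubcontinuum_arc p q) (left_mem_arc _ _) h

theorem IsDendroid.arc_subset_arc_right (hX : IsDendroid X) (h : x ∈ arc p q) :
    arc x q ⊆ arc p q :=
  hX.arc_subset (hX.isSubcontinuum_arc p q) h (right_mem_arc _ _)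

theorem IsDendroid.arc_subset_union (hX : IsDendroid X) (p q r : X) :
    arc p r ⊆ arc p q ∪ arc q r :=
  hX.arc_subset ((hX.isSubcontinuum_arc p q).union (hX.isSubcontinuum_arc q r)
    ⟨q, right_mem_arc _ _, left_mem_arc _ _⟩) (Or.inl (left_mem_arc _ _))
    (Or.inr (right_mem_arc _ _))

theorem isSubcontinuum_image_Icc {f : unitInterval → X} (hf : Continuous f) {a b : unitInterval}
    (h : a ≤ b) : IsSubcontinuum (f '' Icc a b) :=
  ⟨isCompact_Icc.image hf, (isConnected_Icc h).image f hf.continuousOn⟩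

theorem IsDendroid.arc_subset_image_Icc (hX : IsDendroid X) {f : unitInterval → X}
    (hf : Continuous f) {a b : unitInterval} (h : a ≤ b) : arc (f a) (f b) ⊆ f '' Icc a b :=
  hX.arc_subset (isSubcontinuum_image_Icc hf h) (mem_image_of_mem f (left_mem_Icc.2 h))
    (mem_image_of_mem f (right_mem_Icc.2 h))

theorem IsDendroid.arc_inter_arc (hX : IsDendroid X) (h : x ∈ arc p q) :
    arc p x ∩ arc x q ⊆ {x} := by
  rcases eq_or_ne p q with rfl | hpq
  · rw [arc_self] at h
    rw [mem_singleton_iff.1 h, arc_self]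
    exact inter_subset_left
  · obtain ⟨f, hf, h0, h1, hr⟩ := hX.isArc_arc hpq
    rw [← hr] at h
    obtain ⟨s, rfl⟩ := h
    subst h0 h1
    rintro z ⟨hz1, hz2⟩
    obtain ⟨a, ha, rfl⟩ := hX.arc_subset_image_Icc hf.continuous s.2.1 hz1
    obtain ⟨b, hb, hab⟩ := hX.arc_subset_image_Icc hf.continuous s.2.2 hz2
    obtain rfl := hf.injective hab
    rw [le_antisymm ha.2 hb.1]
    rfl

/-- Two arcs that meet only in their common endpoint `e` form an arc through `e`. -/
theorem IsDendroid.mem_arc_of_inter_subset (hX : IsDendroid X)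
    (h : arc e p ∩ arc e q ⊆ {e}) : e ∈ arc p q := by
  have hsub : arc p q ⊆ arc e p ∪ arc e q := by
    rw [hX.arc_comm e p]
    exact hX.arc_subset_union p e q
  obtain ⟨z, hz, hz'⟩ := isPreconnected_closed_iff.1 (hX.isSubcontinuum_arc p q).2.2 _ _
    (hX.isClosed_arc e p) (hX.isClosed_arc e q) hsub
    ⟨p, left_mem_arc _ _, right_mem_arc _ _⟩ ⟨q, right_mem_arc _ _, right_mem_arc _ _⟩
  rwa [← mem_singleton_iff.1 (h hz')]

theorem IsDendroid.exists_mem_arc_ne (hX : IsDendroid X) (h : p ≠ q) :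
    ∃ c ∈ arc p q, c ≠ p ∧ c ≠ q := by
  have hinf := (hX.isSubcontinuum_arc p q).2.2.infinite_of_nontrivial
    ⟨p, left_mem_arc _ _, q, right_mem_arc _ _, h⟩
  obtain ⟨c, hc, hc'⟩ := hinf.exists_notMem_finite (toFinite {p, q})
  simp only [mem_insert_iff, mem_singleton_iff, not_or] at hc'
  exact ⟨c, hc, hc'⟩

/-- The interior of an arc is dense in it. -/
theorem IsDendroid.arc_subset_of_interior_subset (hX : IsDendroid X) (h : p ≠ q) {F : Set X}
    (hF : IsClosed F) (hint : ∀ c ∈ arc p q, c ≠ p → c ≠ q → c ∈ F) : arc p q ⊆ F := by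
  obtain ⟨f, hf, rfl, rfl, hr⟩ := hX.isArc_arc h
  have hcl : closure (Ioo (0 : unitInterval) 1) ⊆ f ⁻¹' F := by
    refine closure_minimal (fun s hs => ?_) (hF.preimage hf.continuous)
    exact hint (f s) (hr ▸ mem_range_self s) (fun h' => hs.1.ne' (hf.injective h'))
      (fun h' => hs.2.ne (hf.injective h'))
  rw [closure_Ioo zero_ne_one] at hcl
  rw [← hr]
  rintro _ ⟨s, rfl⟩
  exact hcl ⟨s.2.1, s.2.2⟩

theorem IsDendroid.mem_arc_antisymm (hX : IsDendroid X) (h1 : x ∈ arc t y) (h2 : y ∈ arc t x) :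
    x = y :=
  (hX.arc_inter_arc h1 ⟨h2, right_mem_arc _ _⟩).symm

theorem IsDendroid.mem_arc_trans (hX : IsDendroid X) (h1 : x ∈ arc t y) (h2 : y ∈ arc t r) :
    x ∈ arc t r :=
  hX.arc_subset_arc_left h2 h1

theorem IsDendroid.mem_arc_of_mem_of_mem (hX : IsDendroid X) (h1 : p ∈ arc t c)
    (h2 : c ∈ arc t x) : c ∈ arc p x := by
  rcases hX.arc_subset_union t p x h2 with h | h
  · rw [hX.mem_arc_antisymm h h1]
    exact left_mem_arc _ _
  · exact h

theorem IsDendroid.left_mem_arc_of_mem (hX : IsDendroid X) (h1 : p ∈ arc t x)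
    (h2 : c ∈ arc p x) : p ∈ arc t c := by
  have hc : c ∈ arc t x := hX.arc_subset_arc_right h1 h2
  rcases hX.arc_subset_union t c x h1 with h | h
  · exact h
  · have := hX.arc_inter_arc h2 ⟨left_mem_arc _ _, h⟩
    rw [mem_singleton_iff.1 this]
    exact right_mem_arc _ _

/-- The arcs `tx` and `ty` have a last common point `z`: they share exactly the arc `tz`. -/
theorem IsDendroid.exists_branch (hX : IsDendroid X) (t x y : X) :
    ∃ z ∈ arc t x, z ∈ arc t y ∧ arc t x ∩ arc t y ⊆ arc t z ∧ arc z x ∩ arc t y ⊆ {z} := by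
  rcases eq_or_ne t x with rfl | htx
  · refine ⟨t, left_mem_arc _ _, left_mem_arc _ _, inter_subset_left, ?_⟩
    rw [arc_self]
    exact inter_subset_left
  obtain ⟨f, hf, h0, h1, hr⟩ := hX.isArc_arc htx
  have hcl : IsCompact (f ⁻¹' arc t y) := ((hX.isClosed_arc t y).preimage hf.continuous).isCompact
  obtain ⟨s, hs, hmax⟩ := hcl.exists_isGreatest
    ⟨0, by rw [mem_preimage, h0]; exact left_mem_arc _ _⟩
  subst h0 h1
  have hsx : f s ∈ arc (f 0) (f 1) := hr ▸ mem_range_self s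
  have key : arc (f s) (f 1) ∩ arc (f 0) y ⊆ {f s} := by
    rintro z ⟨hz1, hz2⟩
    obtain ⟨a, ha, rfl⟩ := hX.arc_subset_image_Icc hf.continuous s.2.2 hz1
    rw [le_antisymm (hmax hz2) ha.1]
    rfl
  refine ⟨f s, hsx, hs, ?_, key⟩
  rintro z ⟨hz1, hz2⟩
  rcases hX.arc_subset_union _ (f s) _ hz1 with h | h
  · exact h
  · rw [mem_singleton_iff.1 (key ⟨h, hz2⟩)]
    exact right_mem_arc _ _

end Arcs

/-! ### The order of points in a fan -/

section Order

variable {X : Type*} [MetricSpace X] {t p q r x y c e : X}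

theorem arc_ne_arc_of_inter_subset (hp : p ≠ e)
    (h : arc e p ∩ arc e q ⊆ {e}) : arc e p ≠ arc e q := fun heq =>
  hp (h ⟨right_mem_arc _ _, heq ▸ right_mem_arc _ _⟩)

theorem arc_inter_arc_eq (h : arc e p ∩ arc e q ⊆ {e}) : arc e p ∩ arc e q = {e} :=
  h.antisymm (singleton_subset_iff.2 ⟨left_mem_arc _ _, left_mem_arc _ _⟩)

/-- In a fan with top `t`, two points are comparable along a leg or lie on different legs. -/
theorem IsFan.mem_or_mem_or_inter (hX : IsFan X) (ht : t ∈ ramificationPoints X) (x y : X) :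
    x ∈ arc t y ∨ y ∈ arc t x ∨ arc t x ∩ arc t y ⊆ {t} := by
  have hD := hX.1
  obtain ⟨z, hzx, hzy, hsub, hbr⟩ := hD.exists_branch t x y
  rcases eq_or_ne z x with rfl | hx
  · exact Or.inl hzy
  rcases eq_or_ne z y with rfl | hy
  · exact Or.inr (Or.inl hzx)
  rcases eq_or_ne z t with rfl | hzt
  · rw [arc_self] at hsub
    exact Or.inr (Or.inr hsub)
  exfalso
  have h12 : arc z t ∩ arc z x ⊆ {z} := by
    rw [hD.arc_comm z t]
    exact hD.arc_inter_arc hzx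
  have h13 : arc z t ∩ arc z y ⊆ {z} := by
    rw [hD.arc_comm z t]
    exact hD.arc_inter_arc hzy
  have h23 : arc z x ∩ arc z y ⊆ {z} := fun w hw =>
    hbr ⟨hw.1, hD.arc_subset_arc_right hzy hw.2⟩
  have hfam : IsArcFamilyAt z {arc z t, arc z x, arc z y} := by
    refine ⟨?_, ?_⟩
    · rintro A (rfl | rfl | rfl)
      exacts [⟨_, hD.isArc_arc hzt⟩, ⟨_, hD.isArc_arc hx⟩, ⟨_, hD.isArc_arc hy⟩]
    · rintro A (rfl | rfl | rfl) B (rfl | rfl | rfl) hAB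
      · exact absurd rfl hAB
      · exact arc_inter_arc_eq h12
      · exact arc_inter_arc_eq h13
      · rw [inter_comm]; exact arc_inter_arc_eq h12
      · exact absurd rfl hAB
      · exact arc_inter_arc_eq h23
      · rw [inter_comm]; exact arc_inter_arc_eq h13
      · rw [inter_comm]; exact arc_inter_arc_eq h23
      · exact absurd rfl hAB
  have hcard : ({arc z t, arc z x, arc z y} : Set (Set X)).encard = 3 :=
    encard_eq_three.2 ⟨_, _, _, arc_ne_arc_of_inter_subset hzt.symm h12,
      arc_ne_arc_of_inter_subset hzt.symm h13, arc_ne_arc_of_inter_subset hx.symm h23, rfl⟩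
  have hram : z ∈ ramificationPoints X := by
    have h3 : (3 : ℕ∞) ≤ ord z := hcard ▸ le_iSup₂ (f := fun (S : Set (Set X))
      (_ : IsArcFamilyAt z S) => S.encard) _ hfam
    exact lt_of_lt_of_le (by norm_num) h3
  exact hzt (hX.2.unique hram ht)

/-- In a fan with top `t`, the endpoints are the points other than `t` that are maximal for the
order `x ≤ y ↔ x ∈ arc t y`. -/
theorem IsFan.mem_endpoints_iff (hX : IsFan X) (ht : t ∈ ramificationPoints X) :
    e ∈ endpoints X ↔ e ≠ t ∧ ∀ y, e ∈ arc t y → y = e := by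
  have hD := hX.1
  constructor
  · intro he
    have he1 : ord e = 1 := he
    have het : e ≠ t := by
      rintro rfl
      have h2 : 2 < ord e := ht
      rw [he1] at h2
      exact absurd h2 (by norm_num)
    refine ⟨het, fun y hy => by_contra fun hye => ?_⟩
    have h12 : arc e t ∩ arc e y ⊆ {e} := by
      rw [hD.arc_comm e t]
      exact hD.arc_inter_arc hy
    have hfam : IsArcFamilyAt e {arc e t, arc e y} := by
      refine ⟨?_, ?_⟩
      · rintro A (rfl | rfl)
        exacts [⟨_, hD.isArc_arc het⟩, ⟨_, hD.isArc_arc (Ne.symm hye)⟩]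
      · rintro A (rfl | rfl) B (rfl | rfl) hAB
        · exact absurd rfl hAB
        · exact arc_inter_arc_eq h12
        · rw [inter_comm]; exact arc_inter_arc_eq h12
        · exact absurd rfl hAB
    have h2 : (2 : ℕ∞) ≤ ord e :=
      encard_pair (arc_ne_arc_of_inter_subset het.symm h12) ▸ le_iSup₂ (f := fun (S : Set (Set X))
        (_ : IsArcFamilyAt e S) => S.encard) _ hfam
    rw [he1] at h2
    exact absurd h2 (by norm_num)
  · rintro ⟨het, hmax⟩
    apply le_antisymm
    · refine iSup₂_le fun S hS => encard_le_one_iff.2 fun A B hA hB => by_contra fun hAB => ?_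
      -- By maximality of `e`, every arc from `e` shares a nondegenerate arc with `et`.
      have key : ∀ C ∈ S, ∃ z ∈ arc t e, z ≠ e ∧ arc z e ⊆ C := by
        intro C hC
        obtain ⟨q, hq⟩ := hS.1 C hC
        have hnot : ¬ arc e t ∩ arc e q ⊆ {e} := fun h =>
          hq.ne (hmax q (hD.mem_arc_of_inter_subset h)).symm
        obtain ⟨z, ⟨hz1, hz2⟩, hz⟩ := not_subset.1 hnot
        rw [hD.arc_comm e t] at hz1
        rw [hD.arc_eq hq] at hz2
        exact ⟨z, hz1, hz, hD.arc_subset hq.isSubcontinuum hz2 hq.left_mem⟩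
      obtain ⟨a, hat, hae, haA⟩ := key A hA
      obtain ⟨b, hbt, hbe, hbB⟩ := key B hB
      have hint := hS.2 hA hB hAB
      rcases hD.arc_subset_union t b e hat with h | h
      · have hb : b ∈ A ∩ B := ⟨haA (hD.mem_arc_of_mem_of_mem h hbt), hbB (left_mem_arc _ _)⟩
        rw [hint] at hb
        exact hbe hb
      · have ha : a ∈ A ∩ B := ⟨haA (left_mem_arc _ _), hbB h⟩
        rw [hint] at ha
        exact hae ha
    · have hfam : IsArcFamilyAt e {arc e t} :=
        ⟨fun A hA => ⟨t, hA ▸ hD.isArc_arc het⟩, pairwise_singleton _ _⟩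
      exact encard_singleton (arc e t) ▸ le_iSup₂ (f := fun (S : Set (Set X))
        (_ : IsArcFamilyAt e S) => S.encard) _ hfam

end Order

/-! ### Every point of a fan lies below an endpoint -/

section Endpoints

variable {X : Type*} [MetricSpace X] {t : X}

theorem IsDendroid.isPreconnected_biUnion_arc (hX : IsDendroid X) (p : X) (C : Set X) :
    IsPreconnected (⋃ q ∈ C, arc p q) := by
  rw [← sUnion_image]
  refine isPreconnected_sUnion p _ ?_ ?_
  · rintro _ ⟨q, -, rfl⟩
    exact left_mem_arc _ _
  · rintro _ ⟨q, -, rfl⟩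
    exact (hX.isSubcontinuum_arc p q).2.2

theorem IsDendroid.isSubcontinuum_closure_biUnion_arc (hX : IsDendroid X) (p : X) {C : Set X}
    (hC : C.Nonempty) : IsSubcontinuum (closure (⋃ q ∈ C, arc p q)) := by
  have := hX.compactSpace
  refine ⟨isClosed_closure.isCompact, ?_, (hX.isPreconnected_biUnion_arc p C).closure⟩
  obtain ⟨q, hq⟩ := hC
  exact ⟨p, subset_closure (mem_biUnion hq (left_mem_arc _ _))⟩

/-- A subcontinuum `K` of a dendroid that contains `p` and is not an arc from `p` contains a
proper subcontinuum through `p` with nonempty interior relative to `K`. -/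
theorem IsDendroid.exists_subcontinuum_interior (hX : IsDendroid X) {K : Set X}
    (hK : IsSubcontinuum K) {p : X} (hp : p ∈ K) (hne : ∀ q ∈ K, arc p q ≠ K) :
    ∃ D ⊆ K, IsSubcontinuum D ∧ p ∈ D ∧ D ≠ K ∧
      ∃ O : Set X, IsOpen O ∧ (O ∩ K).Nonempty ∧ O ∩ K ⊆ D := by
  have := hX.compactSpace
  have : CompactSpace K := isCompact_iff_compactSpace.1 hK.1
  have : Nonempty K := ⟨⟨p, hp⟩⟩
  let B := TopologicalSpace.countableBasis X
  -- `C U` consists of the points whose arc to `p` misses the basic open set `U`.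
  let C : Set X → Set X := fun U => {q | q ∈ K ∧ Disjoint (arc p q) U}
  let I := {U : Set X // U ∈ B ∧ (U ∩ K).Nonempty}
  have : Countable I :=
    ((TopologicalSpace.countable_countableBasis X).mono (fun U hU => hU.1 :
      {U : Set X | U ∈ B ∧ (U ∩ K).Nonempty} ⊆ B)).to_subtype
  have hcov : ⋃ i : I, ((↑) ⁻¹' closure (C i.1) : Set K) = univ := by
    refine eq_univ_of_forall fun q => ?_
    have hsub := hX.arc_subset hK hp q.2
    obtain ⟨k, hk, hkq⟩ := not_subset.1 fun h => hne q q.2 (hsub.antisymm h)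
    obtain ⟨U, hU, hkU, hUs⟩ :=
      (TopologicalSpace.isBasis_countableBasis X).exists_subset_of_mem_open
        (show k ∈ (arc p (q : X))ᶜ from hkq)
        (hX.isClosed_arc p q).isOpen_compl
    exact mem_iUnion.2 ⟨⟨U, hU, k, hkU, hk⟩,
      subset_closure ⟨q.2, (subset_compl_iff_disjoint_left.1 hUs)⟩⟩
  obtain ⟨⟨U, hU, hUK⟩, x, hx⟩ := nonempty_interior_of_iUnion_of_closed
    (fun i : I => (isClosed_closure (s := C i.1)).preimage continuous_subtype_val) hcov
  obtain ⟨O, hO, hOint⟩ := isOpen_induced_iff.1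
    (isOpen_interior (s := ((↑) ⁻¹' closure (C U) : Set K)))
  have hxO : (x : X) ∈ O := by
    have : x ∈ ((↑) ⁻¹' O : Set K) := hOint ▸ hx
    exact this
  have hOK : O ∩ K ⊆ closure (C U) := by
    rintro y ⟨hyO, hyK⟩
    have : (⟨y, hyK⟩ : K) ∈ ((↑) ⁻¹' O : Set K) := hyO
    rw [hOint] at this
    exact (interior_subset this : (⟨y, hyK⟩ : K) ∈ ((↑) ⁻¹' closure (C U) : Set K))
  have hCne : (C U).Nonempty := closure_nonempty_iff.1 ⟨x, hOK ⟨hxO, x.2⟩⟩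
  refine ⟨closure (⋃ q ∈ C U, arc p q), ?_, hX.isSubcontinuum_closure_biUnion_arc p hCne, ?_, ?_,
    O, hO, ⟨x, hxO, x.2⟩, hOK.trans (closure_mono fun q hq => mem_biUnion hq (right_mem_arc _ _))⟩
  · exact closure_minimal (iUnion₂_subset fun q hq => hX.arc_subset hK hp hq.1) hK.1.isClosed
  · obtain ⟨q, hq⟩ := hCne
    exact subset_closure (mem_biUnion hq (left_mem_arc _ _))
  · intro heq
    obtain ⟨k, hkU, hkK⟩ := hUK
    have hUo : IsOpen U := TopologicalSpace.isOpen_of_mem_countableBasis hU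
    have hd : Disjoint (closure (⋃ q ∈ C U, arc p q)) U :=
      Disjoint.closure_left (disjoint_iUnion₂_left.2 fun q hq => hq.2) hUo
    exact disjoint_left.1 hd (heq ▸ hkK) hkU

/-- In a fan, a chain of points along a leg has an upper bound: an increasing union of arcs `tc`
is contained in an arc. If it were not, the limit continuum of its tails would absorb a whole tail
of the union, and such a self-accumulating ray is excluded by the Baire category theorem. -/
theorem IsFan.exists_upper_bound (hX : IsFan X) (ht : t ∈ ramificationPoints X) {C : Set X}
    (hC : IsChain (fun x y => x ∈ arc t y) C) : ∃ ub, ∀ c ∈ C, c ∈ arc t ub := by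
  have hD := hX.1
  have := hD.compactSpace
  rcases C.eq_empty_or_nonempty with rfl | hCne
  · exact ⟨t, by simp⟩
  by_contra! hub
  have htot : ∀ a ∈ C, ∀ b ∈ C, a ∈ arc t b ∨ b ∈ arc t a := by
    intro a ha b hb
    rcases eq_or_ne a b with rfl | hab
    · exact Or.inl (right_mem_arc _ _)
    · exact hC ha hb hab
  have hdir : ∀ a ∈ C, ∀ b ∈ C, ∃ c ∈ C, a ∈ arc t c ∧ b ∈ arc t c := by
    intro a ha b hb
    rcases htot a ha b hb with h | h
    · exact ⟨b, hb, h, right_mem_arc _ _⟩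
    · exact ⟨a, ha, right_mem_arc _ _, h⟩
  -- `T c` is the closed tail beyond `c` of the union of the arcs `tc`.
  let T : X → Set X := fun c => closure (⋃ c' ∈ {c' ∈ C | c ∈ arc t c'}, arc c c')
  have hT : ∀ c ∈ C, IsSubcontinuum (T c) := fun c hc =>
    hD.isSubcontinuum_closure_biUnion_arc c ⟨c, hc, right_mem_arc _ _⟩
  have hTmem : ∀ c ∈ C, ∀ d ∈ C, c ∈ arc t d → ∀ x ∈ arc c d, x ∈ T c := fun c _ d hd hcd x hx =>
    subset_closure (mem_biUnion (show d ∈ {c' ∈ C | c ∈ arc t c'} from ⟨hd, hcd⟩) hx)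
  have hTanti : ∀ c ∈ C, ∀ d ∈ C, c ∈ arc t d → T d ⊆ T c := by
    intro c hc d hd hcd
    refine closure_mono (iUnion₂_subset fun c' hc' => ?_)
    refine fun x hx => mem_biUnion (x := c')
      (show c' ∈ {c' ∈ C | c ∈ arc t c'} from ⟨hc'.1, hD.mem_arc_trans hcd hc'.2⟩) ?_
    have := hD.mem_arc_of_mem_of_mem hcd hc'.2
    exact hD.arc_subset_arc_right this hx
  obtain ⟨k, hk⟩ : (⋂ c : C, T c).Nonempty := by
    have : Nonempty C := hCne.to_subtype
    refine IsCompact.nonempty_iInter_of_directed_nonempty_isCompact_isClosed _ ?_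
      (fun c => (hT c c.2).2.1) (fun c => (hT c c.2).1) (fun c => (hT c c.2).1.isClosed)
    rintro ⟨a, ha⟩ ⟨b, hb⟩
    obtain ⟨c, hc, hac, hbc⟩ := hdir a ha b hb
    exact ⟨⟨c, hc⟩, hTanti a ha c hc hac, hTanti b hb c hc hbc⟩
  replace hk : ∀ c ∈ C, k ∈ T c := fun c hc => mem_iInter.1 hk ⟨c, hc⟩
  -- Some limit point of the tails lies on the union of the arcs.
  obtain ⟨z, hz, a, ha, hza⟩ : ∃ z, (∀ c ∈ C, z ∈ T c) ∧ ∃ a ∈ C, z ∈ arc t a := by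
    by_cases hkR : ∃ a ∈ C, k ∈ arc t a
    · exact ⟨k, hk, hkR⟩
    push Not at hkR
    obtain ⟨b, hb, hbk⟩ := hub k
    refine ⟨t, ?_, b, hb, left_mem_arc _ _⟩
    have aux : ∀ d ∈ C, b ∈ arc t d → t ∈ T d := by
      intro d hd hbd
      rcases hX.mem_or_mem_or_inter ht k d with h | h | h
      · exact absurd h (hkR d hd)
      · exact absurd (hD.mem_arc_trans hbd h) hbk
      · exact hD.arc_subset (hT d hd) (hk d hd) (hTmem d hd d hd (right_mem_arc _ _) d
          (right_mem_arc _ _)) (hD.mem_arc_of_inter_subset h)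
    intro c hc
    obtain ⟨d, hd, hcd, hbd⟩ := hdir c hc b hb
    exact hTanti c hc d hd hcd (aux d hd hbd)
  -- Hence all tails beyond `a` coincide.
  have habs : ∀ d ∈ C, z ∈ arc t d → ∀ x ∈ arc z d, ∀ c ∈ C, x ∈ T c := by
    intro d hd hzd x hx c hc
    obtain ⟨m, hm, hcm, hdm⟩ := hdir c hc d hd
    refine hTanti c hc m hm hcm ?_
    refine hD.arc_subset (hT m hm) (hz m hm) (hTmem m hm m hm (right_mem_arc _ _) m
      (right_mem_arc _ _)) ?_
    exact hD.arc_subset_arc_left (hD.mem_arc_of_mem_of_mem hzd hdm) hx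
  have hTeq : ∀ c ∈ C, T a ⊆ T c := by
    intro c hc
    refine closure_minimal (iUnion₂_subset fun d hd x hx => ?_) (hT c hc).1.isClosed
    have had := hD.mem_arc_of_mem_of_mem hza hd.2
    exact habs d hd.1 (hD.mem_arc_trans hza hd.2) x (hD.arc_subset_arc_right had hx) c hc
  have haT : a ∈ T a := hTmem a ha a ha (right_mem_arc _ _) a (right_mem_arc _ _)
  have hne : ∀ q ∈ T a, arc a q ≠ T a := by
    intro q hq heq
    obtain ⟨b, hb, hba⟩ := hub a
    have hab : a ∈ arc t b := (htot a ha b hb).resolve_right hba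
    have hbq : b ∈ arc a q := heq ▸ hTmem a ha b hb hab b (right_mem_arc _ _)
    have hTb : T b ⊆ arc b q := by
      refine closure_minimal (iUnion₂_subset fun d hd x hx => ?_) (hD.isClosed_arc b q)
      have had := hD.mem_arc_trans hab hd.2
      have hdq : d ∈ arc a q := heq ▸ hTmem a ha d hd.1 had d (right_mem_arc _ _)
      have hbd : b ∈ arc a d := hD.mem_arc_of_mem_of_mem hab hd.2
      exact hD.arc_subset_arc_left (hD.mem_arc_of_mem_of_mem hbd hdq) hx
    have : a ∈ arc a b ∩ arc b q := ⟨left_mem_arc _ _, hTb (hTeq b hb haT)⟩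
    have hab' : a = b := hD.arc_inter_arc hbq this
    exact hba (hab' ▸ right_mem_arc _ _)
  obtain ⟨D, hDK, hDc, haD, hDne, O, hO, ⟨w, hwO, hwK⟩, hOD⟩ :=
    hD.exists_subcontinuum_interior (hT a ha) haT hne
  refine hDne (hDK.antisymm ?_)
  refine closure_minimal (iUnion₂_subset fun d hd => hD.arc_subset hDc haD ?_) hDc.1.isClosed
  -- The tail beyond `d` enters `O`, hence `D`, so `D` contains `d`.
  obtain ⟨x, hxO, hx⟩ := mem_closure_iff.1 (hTeq d hd.1 hwK) O hO hwO
  obtain ⟨d', hd', hxd'⟩ := mem_iUnion₂.1 hx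
  have had' := hD.mem_arc_trans hd.2 hd'.2
  have hdd' : d ∈ arc a d' := hD.mem_arc_of_mem_of_mem hd.2 hd'.2
  have hxad' : x ∈ arc a d' := hD.arc_subset_arc_right hdd' hxd'
  have hxD : x ∈ D := hOD ⟨hxO, hTmem a ha d' hd'.1 had' x hxad'⟩
  exact hD.arc_subset hDc haD hxD (hD.left_mem_arc_of_mem hdd' hxd')

theorem IsFan.exists_endpoint (hX : IsFan X) (ht : t ∈ ramificationPoints X) {x : X}
    (hx : x ≠ t) : ∃ e ∈ endpoints X, x ∈ arc t e := by
  have hD := hX.1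
  obtain ⟨⟨m, hm⟩, hmax⟩ := exists_maximal_of_chains_bounded
    (r := fun a b : {y // x ∈ arc t y} => (a : X) ∈ arc t (b : X)) (by
      intro c hc
      rcases c.eq_empty_or_nonempty with rfl | ⟨d, hd⟩
      · exact ⟨⟨x, right_mem_arc _ _⟩, by simp⟩
      obtain ⟨ub, hub⟩ := hX.exists_upper_bound ht (C := (↑) '' c) (by
        rintro _ ⟨a, ha, rfl⟩ _ ⟨b, hb, rfl⟩ hab
        exact hc ha hb fun h => hab (h ▸ rfl))
      exact ⟨⟨ub, hD.mem_arc_trans d.2 (hub d ⟨d, hd, rfl⟩)⟩, fun a ha => hub a ⟨a, ha, rfl⟩⟩)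
    (fun {a b c} h1 h2 => hD.mem_arc_trans h1 h2)
  refine ⟨m, (hX.mem_endpoints_iff ht).2 ⟨?_, fun y hy => ?_⟩, hm⟩
  · rintro rfl
    rw [arc_self] at hm
    exact hx hm
  · exact hD.mem_arc_antisymm (hmax ⟨y, hD.mem_arc_trans hm hy⟩ hy) hy

theorem IsFan.endpoints_nonempty (hX : IsFan X) (ht : t ∈ ramificationPoints X) :
    (endpoints X).Nonempty := by
  by_contra! hE
  have hall : ∀ x : X, x = t := fun x => by_contra fun hx => by
    obtain ⟨e, he, -⟩ := hX.exists_endpoint ht hx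
    simp [hE] at he
  have h2 : 2 < ord t := ht
  have h0 : ord t ≤ 0 := iSup₂_le fun S hS => by
    rw [nonpos_iff_eq_zero, encard_eq_zero]
    refine eq_empty_of_forall_notMem fun A hA => ?_
    obtain ⟨q, hq⟩ := hS.1 A hA
    exact hq.ne (hall q).symm
  exact absurd (h2.trans_le h0) (by norm_num)

/-- Distinct endpoints lie on legs that meet only in the top. -/
theorem IsFan.endpoint_eq_of_mem (hX : IsFan X) (ht : t ∈ ramificationPoints X) {e e' c : X}
    (he : e ∈ endpoints X) (he' : e' ∈ endpoints X) (hc : c ≠ t) (h : c ∈ arc t e)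
    (h' : c ∈ arc t e') : e = e' := by
  rcases hX.mem_or_mem_or_inter ht e e' with h1 | h1 | h1
  · exact (((hX.mem_endpoints_iff ht).1 he).2 _ h1).symm
  · exact ((hX.mem_endpoints_iff ht).1 he').2 _ h1
  · exact absurd (h1 ⟨h, h'⟩) hc

end Endpoints

/-! ### Semicontinuity of the arcs from a fixed point -/

section Semicontinuity

variable {X : Type*} [MetricSpace X] {t a b c e x y : X} {U V : Set X}

/-- The points `x` whose arc `tx` meets `U`, that is, the points lying beyond some point of `U`
as seen from `t`. -/
def beyond (t : X) (U : Set X) : Set X := {x | (arc t x ∩ U).Nonempty}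

/-- The topological upper limit of the arcs `tz` as `z` tends to `y`: the points `x` such that
arcs `tz` with `z` arbitrarily close to `y` pass arbitrarily close to `x`. -/
def upperLimit (t y : X) : Set X := {x | ∀ U, IsOpen U → x ∈ U → y ∈ closure (beyond t U)}

theorem subset_beyond : U ⊆ beyond t U := fun x hx => ⟨x, right_mem_arc _ _, hx⟩

theorem beyond_mono (h : U ⊆ V) : beyond t U ⊆ beyond t V := fun _ ⟨z, hz, hzU⟩ => ⟨z, hz, h hzU⟩

theorem IsDendroid.mem_beyond_of_mem_arc (hX : IsDendroid X) (hx : x ∈ beyond t U)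
    (hxy : x ∈ arc t y) : y ∈ beyond t U := by
  obtain ⟨z, hz, hzU⟩ := hx
  exact ⟨z, hX.mem_arc_trans hz hxy, hzU⟩

theorem IsDendroid.beyond_beyond (hX : IsDendroid X) : beyond t (beyond t U) = beyond t U :=
  Subset.antisymm (fun _ ⟨_, hz, hzU⟩ => hX.mem_beyond_of_mem_arc hzU hz) subset_beyond

theorem IsDendroid.isPreconnected_compl_beyond (hX : IsDendroid X) :
    IsPreconnected (beyond t U)ᶜ := by
  refine isPreconnected_of_forall t fun y hy => ⟨arc t y, fun x hx hxU => ?_, left_mem_arc _ _,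
    right_mem_arc _ _, (hX.isSubcontinuum_arc t y).2.2⟩
  exact hy (hX.mem_beyond_of_mem_arc hxU hx)

/-- Lower semicontinuity of `x ↦ tx`. If `x` is a limit of points whose arcs from `t` miss `U`,
then the closure of the union of these arcs is a subcontinuum missing `U`, and it contains `tx`. -/
theorem IsDendroid.isOpen_beyond (hX : IsDendroid X) (hU : IsOpen U) : IsOpen (beyond t U) := by
  rw [← isClosed_compl_iff]
  refine isClosed_of_closure_subset fun x hx => ?_
  have hne : (beyond t U)ᶜ.Nonempty := closure_nonempty_iff.1 ⟨x, hx⟩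
  have hK := hX.isSubcontinuum_closure_biUnion_arc t hne
  have hxK : x ∈ closure (⋃ q ∈ (beyond t U)ᶜ, arc t q) :=
    closure_mono (fun q hq => mem_biUnion hq (right_mem_arc _ _)) hx
  obtain ⟨q, hq⟩ := hne
  have htK : t ∈ closure (⋃ q ∈ (beyond t U)ᶜ, arc t q) :=
    subset_closure (mem_biUnion hq (left_mem_arc _ _))
  have hd : Disjoint (closure (⋃ q ∈ (beyond t U)ᶜ, arc t q)) U :=
    Disjoint.closure_left (disjoint_iUnion₂_left.2 fun q hq =>
      disjoint_iff_inter_eq_empty.2 (not_nonempty_iff_eq_empty.1 hq)) hU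
  rintro ⟨z, hz, hzU⟩
  exact disjoint_left.1 hd (hX.arc_subset hK htK hxK hz) hzU

theorem isClosed_upperLimit (t y : X) : IsClosed (upperLimit t y) := by
  refine isClosed_of_closure_subset fun x hx U hU hxU => ?_
  obtain ⟨z, hzU, hz⟩ := mem_closure_iff.1 hx U hU hxU
  exact hz U hU hzU

theorem isClosed_setOf_mem_upperLimit (t x : X) : IsClosed {y | x ∈ upperLimit t y} := by
  have : {y | x ∈ upperLimit t y} = ⋂ (U : Set X) (_ : IsOpen U) (_ : x ∈ U),
      closure (beyond t U) := by
    ext y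
    simp [upperLimit]
  rw [this]
  exact isClosed_iInter fun U => isClosed_iInter fun _ => isClosed_iInter fun _ => isClosed_closure

theorem IsDendroid.arc_subset_upperLimit (hX : IsDendroid X) (hx : x ∈ upperLimit t y) :
    arc t x ⊆ upperLimit t y := by
  intro c hc U hU hcU
  rw [← hX.beyond_beyond]
  exact hx _ (hX.isOpen_beyond hU) ⟨c, hc, hcU⟩

/-- If connected subsets of a closed set `Z` join points arbitrarily close to `a` to points
arbitrarily close to `b`, then `Z` contains the arc `ab`. -/
theorem IsDendroid.arc_subset_of_forall_nhds (hX : IsDendroid X) {Z : Set X} (hZ : IsClosed Z)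
    (h : ∀ N M : Set X, IsOpen N → IsOpen M → a ∈ N → b ∈ M →
      ∃ C ⊆ Z, IsPreconnected C ∧ (C ∩ N).Nonempty ∧ (C ∩ M).Nonempty) : arc a b ⊆ Z := by
  have := hX.compactSpace
  have : CompactSpace Z := isCompact_iff_compactSpace.1 hZ.isCompact
  have haZ : a ∈ Z := by
    rw [← hZ.closure_eq]
    refine mem_closure_iff.2 fun N hN haN => ?_
    obtain ⟨C, hC, -, ⟨x, hxC, hxN⟩, -⟩ := h N univ hN isOpen_univ haN (mem_univ b)
    exact ⟨x, hxN, hC hxC⟩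
  have hbZ : b ∈ Z := by
    rw [← hZ.closure_eq]
    refine mem_closure_iff.2 fun M hM hbM => ?_
    obtain ⟨C, hC, -, -, ⟨x, hxC, hxM⟩⟩ := h univ M isOpen_univ hM (mem_univ a) hbM
    exact ⟨x, hxM, hC hxC⟩
  -- Otherwise a clopen subset `Q` of `Z` separates `a` from `b`.
  have hcomp : (⟨b, hbZ⟩ : Z) ∈ connectedComponent (⟨a, haZ⟩ : Z) := by
    rw [connectedComponent_eq_iInter_isClopen, mem_iInter]
    rintro ⟨Q, hQ, haQ⟩
    by_contra hbQ
    obtain ⟨N, hN, hNQ⟩ := isOpen_induced_iff.1 hQ.isOpen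
    obtain ⟨M, hM, hMQ⟩ := isOpen_induced_iff.1 hQ.compl.isOpen
    have haN : (⟨a, haZ⟩ : Z) ∈ ((↑) ⁻¹' N : Set Z) := hNQ ▸ haQ
    have hbM : (⟨b, hbZ⟩ : Z) ∈ ((↑) ⁻¹' M : Set Z) := hMQ ▸ hbQ
    obtain ⟨C, hCZ, hC, ⟨x, hxC, hxN⟩, ⟨y, hyC, hyM⟩⟩ := h N M hN hM haN hbM
    have hC' : IsPreconnected ((↑) ⁻¹' C : Set Z) := by
      rw [← Topology.IsInducing.subtypeVal.isPreconnected_image, Subtype.image_preimage_coe,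
        inter_eq_right.2 hCZ]
      exact hC
    have hxQ : (⟨x, hCZ hxC⟩ : Z) ∈ Q := by rw [← hNQ]; exact hxN
    have hyQ : (⟨y, hCZ hyC⟩ : Z) ∈ Qᶜ := by rw [← hMQ]; exact hyM
    exact hyQ (hC'.subset_isClopen hQ ⟨_, hxC, hxQ⟩ hyC)
  have hK : IsSubcontinuum ((↑) '' connectedComponent (⟨a, haZ⟩ : Z) : Set X) :=
    ⟨isClosed_connectedComponent.isCompact.image continuous_subtype_val,
      isConnected_connectedComponent.image _ continuous_subtype_val.continuousOn⟩
  refine (hX.arc_subset hK ⟨_, mem_connectedComponent, rfl⟩ ⟨_, hcomp, rfl⟩).trans ?_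
  exact Subtype.coe_image_subset _ _

/-- If arcs `tz` with `z → a` pass near `b`, then the parts of these arcs between `b` and `a`
accumulate on the whole arc `ab`. -/
theorem IsDendroid.mem_upperLimit_of_mem_arc (hX : IsDendroid X) (hb : b ∈ upperLimit t a)
    (hc : c ∈ arc a b) : b ∈ upperLimit t c := by
  intro U hU hbU
  refine hX.arc_subset_of_forall_nhds isClosed_closure (fun N M hN hM haN hbM => ?_) hc
  obtain ⟨z, hzN, u, hu, huU, huM⟩ :=
    mem_closure_iff.1 (hb (U ∩ M) (hU.inter hM) ⟨hbU, hbM⟩) N hN haN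
  refine ⟨arc u z, fun w hw => subset_closure ⟨u, hX.left_mem_arc_of_mem hu hw, huU⟩,
    (hX.isSubcontinuum_arc u z).2.2, ⟨z, right_mem_arc _ _, hzN⟩, ⟨u, left_mem_arc _ _, huM⟩⟩

/-- If `b` does not lie on `tx`, then the arcs `tb` and `xb` have a common terminal part. -/
theorem IsDendroid.exists_mem_arc_inter (hX : IsDendroid X) (h : b ∉ arc t x) :
    ∃ c ∈ arc t b, c ∈ arc x b ∧ c ≠ b ∧ c ≠ t := by
  obtain ⟨z, ⟨hzt, hzx⟩, hzb⟩ := not_subset.1 fun h' => h (hX.mem_arc_of_inter_subset h')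
  rw [hX.arc_comm b t] at hzt
  rw [hX.arc_comm b x] at hzx
  obtain ⟨c, hc, hcz, hcb⟩ := hX.exists_mem_arc_ne (p := z) (q := b) hzb
  refine ⟨c, hX.arc_subset_arc_right hzt hc, hX.arc_subset_arc_right hzx hc, hcb, ?_⟩
  rintro rfl
  have := hX.left_mem_arc_of_mem hzt hc
  rw [arc_self] at this
  exact hcz (this.symm)

/-- Smoothness at `t` with respect to `y` is upper semicontinuity of `z ↦ tz` at `y`. -/
theorem IsDendroid.mem_smoothnessSet_iff (hX : IsDendroid X) :
    y ∈ smoothnessSet t ↔ upperLimit t y ⊆ arc t y := by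
  have := hX.compactSpace
  constructor
  · intro hy x hx
    have hn : ∀ n : ℕ, ∃ z ∈ Metric.ball y (1 / (n + 1 : ℝ)),
        z ∈ beyond t (Metric.ball x (1 / (n + 1 : ℝ))) := fun n =>
      mem_closure_iff.1 (hx _ Metric.isOpen_ball (Metric.mem_ball_self Nat.one_div_pos_of_nat)) _
        Metric.isOpen_ball (Metric.mem_ball_self Nat.one_div_pos_of_nat)
    choose u hu hu' using hn
    choose v hv hv' using hu'
    have hlim : Tendsto u atTop (𝓝 y) := tendsto_iff_dist_tendsto_zero.2
      (squeeze_zero (fun _ => dist_nonneg) (fun n => (Metric.mem_ball.1 (hu n)).le)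
        tendsto_one_div_add_atTop_nhds_zero_nat)
    have hlim' : Tendsto v atTop (𝓝 x) := tendsto_iff_dist_tendsto_zero.2
      (squeeze_zero (fun _ => dist_nonneg) (fun n => (Metric.mem_ball.1 (hv' n)).le)
        tendsto_one_div_add_atTop_nhds_zero_nat)
    have h0 : Tendsto (fun n => Metric.infEDist (v n) (arc t y)) atTop (𝓝 0) :=
      tendsto_of_tendsto_of_tendsto_of_le_of_le tendsto_const_nhds (hy u hlim)
        (fun _ => zero_le) fun n => Metric.infEDist_le_hausdorffEDist_of_mem (hv n)
    have h1 : Tendsto (fun n => Metric.infEDist (v n) (arc t y)) atTop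
        (𝓝 (Metric.infEDist x (arc t y))) :=
      (Metric.continuous_infEDist.tendsto x).comp hlim'
    exact (Metric.mem_iff_infEDist_zero_of_closed (hX.isClosed_arc t y)).2
      (tendsto_nhds_unique h1 h0)
  · intro hy u hu
    refine ENNReal.tendsto_nhds_zero.2 fun ε hε => ?_
    have hε2 : 0 < ε / 2 := ENNReal.half_pos hε.ne'
    -- The arcs near `ty` pass near each of finitely many points that are `ε / 2`-dense in `ty`.
    have h1 : ∀ᶠ n in atTop, ∀ x ∈ arc t y, ∃ z ∈ arc t (u n), edist x z ≤ ε := by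
      obtain ⟨s, hs, hcov⟩ := (hX.isSubcontinuum_arc t y).1.elim_nhds_subcover
        (fun x => Metric.eball x (ε / 2)) fun x _ => Metric.eball_mem_nhds x hε2
      have hev : ∀ᶠ n in atTop, ∀ x ∈ s, u n ∈ beyond t (Metric.eball x (ε / 2)) :=
        (eventually_all_finset s).2 fun x hx => hu.eventually
          ((hX.isOpen_beyond Metric.isOpen_eball).mem_nhds
            ⟨x, hs x hx, Metric.mem_eball_self hε2⟩)
      filter_upwards [hev] with n hn x hx
      obtain ⟨p, hp, hxp⟩ := mem_iUnion₂.1 (hcov hx)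
      obtain ⟨z, hz, hzp⟩ := hn p hp
      refine ⟨z, hz, ?_⟩
      calc edist x z ≤ edist x p + edist z p := edist_triangle_right _ _ _
        _ ≤ ε / 2 + ε / 2 := add_le_add (Metric.mem_eball.1 hxp).le (Metric.mem_eball.1 hzp).le
        _ = ε := ENNReal.add_halves ε
    -- Near `y` no arc meets the compact set of points at distance at least `ε` from `ty`.
    have h2 : ∀ᶠ n in atTop, ∀ z ∈ arc t (u n), Metric.infEDist z (arc t y) ≤ ε := by
      have hZ : IsCompact {z | ε ≤ Metric.infEDist z (arc t y)} :=
        (isClosed_le continuous_const Metric.continuous_infEDist).isCompact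
      have hloc : ∀ z ∈ {z | ε ≤ Metric.infEDist z (arc t y)}, ∃ U, IsOpen U ∧ z ∈ U ∧
          y ∉ closure (beyond t U) := by
        intro z hz
        have : z ∉ upperLimit t y := fun hzL => by
          have h0 := Metric.infEDist_zero_of_mem (hy hzL)
          have hz' : ε ≤ Metric.infEDist z (arc t y) := hz
          rw [h0] at hz'
          exact hε.not_ge hz'
        simp only [upperLimit, mem_ofPred_eq, not_forall] at this
        obtain ⟨U, hU, hzU, hyU⟩ := this
        exact ⟨U, hU, hzU, hyU⟩
      choose! O hO hzO hyO using hloc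
      obtain ⟨s, hs, hcov⟩ := hZ.elim_nhds_subcover O fun z hz => (hO z hz).mem_nhds (hzO z hz)
      have hev : ∀ᶠ n in atTop, ∀ x ∈ s, u n ∉ beyond t (O x) :=
        (eventually_all_finset s).2 fun x hx => (hu.eventually
          (isClosed_closure.isOpen_compl.mem_nhds (hyO x (hs x hx)))).mono
            fun n hn h => hn (subset_closure h)
      filter_upwards [hev] with n hn z hz
      by_contra! hlt
      obtain ⟨p, hp, hzp⟩ := mem_iUnion₂.1 (hcov hlt.le)
      exact hn p hp ⟨z, hz, hzp⟩
    filter_upwards [h1, h2] with n hn1 hn2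
    refine Metric.hausdorffEDist_le_of_infEDist hn2 fun x hx => ?_
    obtain ⟨z, hz, hxz⟩ := hn1 x hx
    exact (Metric.infEDist_le_edist_of_mem hz).trans hxz

/-- The lower semicontinuous map `y ↦ ty` is continuous off the frontiers of the sets `beyond t U`
for basic open `U`, hence on a residual set. -/
theorem IsDendroid.dense_smoothnessSet (hX : IsDendroid X) (t : X) : Dense (smoothnessSet t) := by
  have := hX.compactSpace
  let B := TopologicalSpace.countableBasis X
  have : Countable B := (TopologicalSpace.countable_countableBasis X).to_subtype
  have hBo : ∀ U : B, IsOpen (U : Set X) := fun U =>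
    TopologicalSpace.isOpen_of_mem_countableBasis U.2
  refine (dense_iInter_of_isOpen (f := fun U : B => (frontier (beyond t (U : Set X)))ᶜ)
    (fun U => isClosed_frontier.isOpen_compl) fun U => ?_).mono fun y hy => ?_
  · rw [← interior_eq_empty_iff_dense_compl]
    rw [← frontier_compl]
    exact interior_frontier (hX.isOpen_beyond (hBo U)).isClosed_compl
  · refine hX.mem_smoothnessSet_iff.2 fun x hx => by_contra fun hxy => ?_
    obtain ⟨U, hU, hxU, hUs⟩ :=
      (TopologicalSpace.isBasis_countableBasis X).exists_subset_of_mem_open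
        (show x ∈ (arc t y)ᶜ from hxy) (hX.isClosed_arc t y).isOpen_compl
    refine mem_iInter.1 hy ⟨U, hU⟩ ?_
    rw [(hX.isOpen_beyond (hBo ⟨U, hU⟩)).frontier_eq]
    refine ⟨hx U (hBo ⟨U, hU⟩) hxU, ?_⟩
    rintro ⟨z, hz, hzU⟩
    exact hUs hzU hz

/-- `X` is colocally connected at `e` if no arcs from `t` passing near `e` end away from `e`. -/
theorem IsDendroid.isColocallyConnectedAt (hX : IsDendroid X) (het : e ≠ t)
    (h : ∀ x, e ∈ upperLimit t x → x = e) : IsColocallyConnectedAt e := by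
  have := hX.compactSpace
  intro U hU
  have hZ : IsCompact (interior U)ᶜ := isOpen_interior.isClosed_compl.isCompact
  have hloc : ∀ z ∈ (interior U)ᶜ, ∃ O, IsOpen O ∧ e ∈ O ∧ z ∉ closure (beyond t O) := by
    intro z hz
    have : e ∉ upperLimit t z := fun he => hz (h z he ▸ mem_interior_iff_mem_nhds.2 hU)
    simp only [upperLimit, mem_ofPred_eq, not_forall] at this
    obtain ⟨O, hO, heO, hzO⟩ := this
    exact ⟨O, hO, heO, hzO⟩
  choose! O hO heO hzO using hloc
  obtain ⟨s, hs, hcov⟩ := hZ.elim_nhds_subcover (fun z => (closure (beyond t (O z)))ᶜ)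
    fun z hz => isClosed_closure.isOpen_compl.mem_nhds (hzO z hz)
  let W : Set X := (⋂ z ∈ s, O z) ∩ {t}ᶜ
  have hW : IsOpen W :=
    (isOpen_biInter_finset fun z hz => hO z (hs z hz)).inter isOpen_compl_singleton
  have heW : e ∈ W := ⟨mem_iInter₂.2 fun z hz => heO z (hs z hz), het⟩
  refine ⟨beyond t W, (hX.isOpen_beyond hW).mem_nhds (subset_beyond heW), fun x hx => ?_,
    ⟨t, ?_⟩, hX.isPreconnected_compl_beyond⟩
  · by_contra hxU
    obtain ⟨z, hz, hxz⟩ := mem_iUnion₂.1 (hcov fun h' => hxU (interior_subset h'))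
    exact hxz (subset_closure (beyond_mono (fun w hw => mem_iInter₂.1 hw.1 z hz) hx))
  · rintro ⟨z, hz, hzW⟩
    rw [arc_self] at hz
    exact hzW.2 hz

end Semicontinuity

/-! ### Homeomorphisms and orbits -/

section Homeomorphisms

variable {X : Type*} [MetricSpace X] {t a b c e x y p q : X} {U V : Set X}

theorem IsArc.image {A : Set X} (hA : IsArc A p q) (h : X ≃ₜ X) : IsArc (h '' A) (h p) (h q) := by
  obtain ⟨f, hf, rfl, rfl, rfl⟩ := hA
  exact ⟨h ∘ f, h.isEmbedding.comp hf, rfl, rfl, range_comp h f⟩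

theorem IsDendroid.image_arc (hX : IsDendroid X) (h : X ≃ₜ X) (p q : X) :
    h '' arc p q = arc (h p) (h q) := by
  rcases eq_or_ne p q with rfl | hpq
  · simp [arc_self]
  · exact (hX.arc_eq ((hX.isArc_arc hpq).image h)).symm

theorem ord_le_ord_homeomorph (h : X ≃ₜ X) (p : X) : ord p ≤ ord (h p) := by
  refine iSup₂_le fun S hS => ?_
  have hfam : IsArcFamilyAt (h p) ((fun A => h '' A) '' S) := by
    refine ⟨?_, ?_⟩
    · rintro _ ⟨A, hA, rfl⟩
      obtain ⟨q, hq⟩ := hS.1 A hA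
      exact ⟨h q, hq.image h⟩
    · rintro _ ⟨A, hA, rfl⟩ _ ⟨B, hB, rfl⟩ hAB
      simp only
      rw [← image_inter h.injective, hS.2 hA hB fun h' => hAB (h' ▸ rfl), image_singleton]
  rw [← (h.injective.image_injective).encard_image S]
  exact le_iSup₂ (f := fun (S : Set (Set X)) (_ : IsArcFamilyAt (h p) S) => S.encard) _ hfam

theorem ord_homeomorph (h : X ≃ₜ X) (p : X) : ord (h p) = ord p := by
  refine le_antisymm ?_ (ord_le_ord_homeomorph h p)
  simpa using ord_le_ord_homeomorph h.symm (h p)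

theorem map_mem_endpoints_iff (h : X ≃ₜ X) : h e ∈ endpoints X ↔ e ∈ endpoints X := by
  simp [endpoints, ord_homeomorph]

theorem IsFan.map_top (hX : IsFan X) (ht : t ∈ ramificationPoints X) (h : X ≃ₜ X) : h t = t :=
  hX.2.unique (show 2 < ord (h t) from (ord_homeomorph h t).symm ▸ ht) ht

theorem IsFan.map_eq_top_iff (hX : IsFan X) (ht : t ∈ ramificationPoints X) (h : X ≃ₜ X) :
    h x = t ↔ x = t := by
  conv_lhs => rw [← hX.map_top ht h]
  exact h.injective.eq_iff

theorem IsFan.image_arc_top (hX : IsFan X) (ht : t ∈ ramificationPoints X) (h : X ≃ₜ X) (x : X) :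
    h '' arc t x = arc t (h x) := by
  rw [hX.1.image_arc, hX.map_top ht]

theorem IsFan.map_mem_upperLimit (hX : IsFan X) (ht : t ∈ ramificationPoints X) (h : X ≃ₜ X)
    (hb : b ∈ upperLimit t a) : h b ∈ upperLimit t (h a) := by
  intro U hU hbU
  have ha := hb (h ⁻¹' U) (hU.preimage h.continuous) hbU
  refine closure_mono ?_ (image_closure_subset_closure_image h.continuous (mem_image_of_mem h ha))
  rintro _ ⟨z, ⟨w, hw, hwU⟩, rfl⟩
  exact ⟨h w, hX.image_arc_top ht h z ▸ mem_image_of_mem h hw, hwU⟩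

/-- The ordinary points of `X` with respect to `t`: neither `t` nor an endpoint. -/
def ordinaryPoints (t : X) : Set X := {c | c ≠ t ∧ c ∉ endpoints X}

theorem IsFan.map_mem_ordinaryPoints (hX : IsFan X) (ht : t ∈ ramificationPoints X) (h : X ≃ₜ X)
    (hc : c ∈ ordinaryPoints t) : h c ∈ ordinaryPoints t :=
  ⟨fun h' => hc.1 ((hX.map_eq_top_iff ht h).1 h'), fun h' => hc.2 ((map_mem_endpoints_iff h).1 h')⟩

theorem IsFan.mem_ordinaryPoints (hX : IsFan X) (ht : t ∈ ramificationPoints X) (hc : c ∈ arc t x)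
    (hct : c ≠ t) (hcx : c ≠ x) : c ∈ ordinaryPoints t :=
  ⟨hct, fun he => hcx (((hX.mem_endpoints_iff ht).1 he).2 x hc).symm⟩

theorem IsFan.top_notMem_endpoints (hX : IsFan X) (ht : t ∈ ramificationPoints X) :
    t ∉ endpoints X := fun h => ((hX.mem_endpoints_iff ht).1 h).1 rfl

theorem mem_homeoOrbit_self (x : X) : x ∈ homeoOrbit x := ⟨Homeomorph.refl X, rfl⟩

/-- In a fan of homogeneity degree `3`, the three orbits are the top, the endpoints and the
ordinary points. -/
theorem IsFan.exists_homeomorph (hX : IsFan X) (ht : t ∈ ramificationPoints X)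
    (hdeg : homogeneityDegree X = 3) :
    (∀ e ∈ endpoints X, ∀ e' ∈ endpoints X, ∃ h : X ≃ₜ X, h e = e') ∧
      ∀ c ∈ ordinaryPoints t, ∀ c' ∈ ordinaryPoints t, ∃ h : X ≃ₜ X, h c = c' := by
  obtain ⟨e₀, he₀⟩ := hX.endpoints_nonempty ht
  have het := ((hX.mem_endpoints_iff ht).1 he₀).1
  obtain ⟨c₀, hc, hct, hce⟩ := hX.1.exists_mem_arc_ne het.symm
  have hc₀ := hX.mem_ordinaryPoints ht hc hct hce
  have horbE : ∀ e ∈ endpoints X, homeoOrbit e ⊆ endpoints X := by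
    rintro e he _ ⟨h, rfl⟩
    exact (map_mem_endpoints_iff h).2 he
  have horbO : ∀ c ∈ ordinaryPoints t, homeoOrbit c ⊆ ordinaryPoints t := by
    rintro c hc _ ⟨h, rfl⟩
    exact hX.map_mem_ordinaryPoints ht h hc
  have horbt : homeoOrbit t ⊆ {t} := by
    rintro _ ⟨h, rfl⟩
    exact hX.map_top ht h
  have h1 : homeoOrbit t ≠ homeoOrbit e₀ := fun h =>
    hX.top_notMem_endpoints ht (horbE e₀ he₀ (h ▸ mem_homeoOrbit_self t))
  have h2 : homeoOrbit t ≠ homeoOrbit c₀ := fun h =>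
    (horbO c₀ hc₀ (h ▸ mem_homeoOrbit_self t)).1 rfl
  have h3 : homeoOrbit e₀ ≠ homeoOrbit c₀ := fun h =>
    (horbO c₀ hc₀ (h ▸ mem_homeoOrbit_self e₀)).2 he₀
  have hsub : ({homeoOrbit t, homeoOrbit e₀, homeoOrbit c₀} : Set (Set X)) ⊆
      range (homeoOrbit : X → Set X) := by
    rintro _ (rfl | rfl | rfl) <;> exact mem_range_self _
  have hcard : ({homeoOrbit t, homeoOrbit e₀, homeoOrbit c₀} : Set (Set X)).encard = 3 :=
    encard_eq_three.2 ⟨_, _, _, h1, h2, h3, rfl⟩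
  have hfin : (range (homeoOrbit : X → Set X)).Finite := by
    rw [← encard_ne_top_iff]
    exact fun h => absurd (hdeg.symm.trans h) (by norm_num)
  have heq := (hfin.subset hsub).eq_of_subset_of_encard_le hsub (hdeg.le.trans hcard.ge)
  have hall : ∀ x : X, x ∈ homeoOrbit t ∨ x ∈ homeoOrbit e₀ ∨ x ∈ homeoOrbit c₀ := by
    intro x
    have hx : homeoOrbit x ∈ ({homeoOrbit t, homeoOrbit e₀, homeoOrbit c₀} : Set (Set X)) :=
      heq ▸ mem_range_self x
    rcases hx with h | h | h
    exacts [Or.inl (h ▸ mem_homeoOrbit_self x), Or.inr (Or.inl (h ▸ mem_homeoOrbit_self x)),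
      Or.inr (Or.inr ((mem_singleton_iff.1 h) ▸ mem_homeoOrbit_self x))]
  have hE : ∀ e ∈ endpoints X, e ∈ homeoOrbit e₀ := by
    intro e he
    rcases hall e with h | h | h
    · exact absurd ((horbt h : e = t) ▸ he) (hX.top_notMem_endpoints ht)
    · exact h
    · exact absurd he (horbO c₀ hc₀ h).2
  have hO : ∀ c ∈ ordinaryPoints t, c ∈ homeoOrbit c₀ := by
    intro c hc
    rcases hall c with h | h | h
    · exact absurd (horbt h) hc.1
    · exact absurd (horbE e₀ he₀ h) hc.2
    · exact h
  have htrans : ∀ x y z : X, y ∈ homeoOrbit x → z ∈ homeoOrbit x → ∃ h : X ≃ₜ X, h y = z := by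
    rintro x _ _ ⟨g, rfl⟩ ⟨h, rfl⟩
    exact ⟨g.symm.trans h, by simp⟩
  exact ⟨fun e he e' he' => htrans _ _ _ (hE e he) (hE e' he'),
    fun c hc c' hc' => htrans _ _ _ (hO c hc) (hO c' hc')⟩

end Homeomorphisms

/-! ### Arcs cannot oscillate near the top -/

section Oscillation

variable {X : Type*} [MetricSpace X] {t a b c e x y p q : X} {U V : Set X}

/-- The points `x` at distance more than `δ` from `t` such that the arc `tx`, before ending
at `x`, goes beyond distance `δ` from `t` and back to within `δ / 2` of `t` at least `k` times. -/
def excursions (t : X) (δ : ℝ) : ℕ → Set X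
  | 0 => {x | δ < dist x t}
  | k + 1 => {x | δ < dist x t} ∩ beyond t (beyond t (excursions t δ k) ∩ Metric.ball t (δ / 2))

theorem excursions_subset (t : X) (δ : ℝ) (k : ℕ) : excursions t δ k ⊆ {x | δ < dist x t} := by
  cases k with
  | zero => exact Subset.rfl
  | succ k => exact inter_subset_left

theorem IsDendroid.isOpen_excursions (hX : IsDendroid X) (t : X) (δ : ℝ) (k : ℕ) :
    IsOpen (excursions t δ k) := by
  have h0 : IsOpen {x : X | δ < dist x t} :=
    isOpen_lt continuous_const (continuous_id.dist continuous_const)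
  induction k with
  | zero => exact h0
  | succ k ih => exact h0.inter (hX.isOpen_beyond ((hX.isOpen_beyond ih).inter Metric.isOpen_ball))

/-- By uniform continuity, an arc makes only finitely many excursions. -/
theorem IsDendroid.iInter_excursions (hX : IsDendroid X) (t : X) {δ : ℝ} (hδ : 0 < δ) :
    ⋂ k, excursions t δ k = ∅ := by
  refine eq_empty_of_forall_notMem fun x hx => ?_
  rw [mem_iInter] at hx
  have hxt : t ≠ x := by
    rintro rfl
    have : δ < dist t t := hx 0
    rw [dist_self] at this
    exact hδ.not_gt this
  obtain ⟨f, hf, h0, h1, hr⟩ := hX.isArc_arc hxt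
  obtain ⟨η, hη, hfη⟩ := Metric.uniformContinuous_iff.1
    (CompactSpace.uniformContinuous_of_continuous hf.continuous) (δ / 2) (half_pos hδ)
  have hle : ∀ s : unitInterval, arc t (f s) ⊆ f '' Icc 0 s := fun s =>
    h0 ▸ hX.arc_subset_image_Icc hf.continuous s.2.1
  have key : ∀ k : ℕ, ∀ s : unitInterval, f s ∈ excursions t δ k → k * η ≤ s := by
    intro k
    induction k with
    | zero => intro s _; simpa using s.2.1
    | succ k ih =>
      rintro s ⟨-, b, hbs, ⟨g, hgb, hg⟩, hb⟩
      obtain ⟨r, hrs, rfl⟩ := hle s hbs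
      obtain ⟨q, hqr, rfl⟩ := hle r hgb
      have hq := ih q hg
      have hgt : δ < dist (f q) t := excursions_subset t δ k hg
      have hbt : dist (f r) t < δ / 2 := hb
      have hqr' : (q : ℝ) ≤ r := hqr.2
      have hrs' : (r : ℝ) ≤ s := hrs.2
      have hfar : η ≤ dist q r := by
        by_contra! hlt
        have h1 := hfη hlt
        have h2 := dist_triangle (f q) (f r) t
        linarith
      rw [Subtype.dist_eq, Real.dist_eq, abs_sub_comm, abs_of_nonneg (sub_nonneg.2 hqr')] at hfar
      push_cast
      linarith
  obtain ⟨n, hn⟩ := exists_nat_gt (1 / η)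
  have hle1 := key n 1 (h1 ▸ hx n)
  rw [div_lt_iff₀ hη] at hn
  rw [Set.Icc.coe_one] at hle1
  linarith

/-- Some open set `U` has a point `y` beyond it whose arc `ty` is not contained in the closure of
the set of points beyond `U`. Otherwise, for every nonempty open `U` away from `t`, some arc from
`t` meets `U`, comes back near `t`, and then ends in `U`; inductively the points whose arcs make `k`
excursions are dense away from `t` for each `k`, and the Baire category theorem yields an arc with
infinitely many. -/
theorem IsDendroid.exists_not_arc_subset_closure_beyond (hX : IsDendroid X) (hxt : x ≠ t) :
    ∃ U, IsOpen U ∧ ∃ y ∈ beyond t U, ¬ arc t y ⊆ closure (beyond t U) := by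
  by_contra! hcon
  have := hX.compactSpace
  obtain ⟨δ, hδ, hδx⟩ := exists_between (dist_pos.2 hxt)
  let G : Set X := {y | δ < dist y t}
  have hG : IsOpen G := isOpen_lt continuous_const (continuous_id.dist continuous_const)
  have hdense : ∀ k, ∀ U ⊆ G, IsOpen U → U.Nonempty → (U ∩ excursions t δ k).Nonempty := by
    intro k
    induction k with
    | zero => exact fun U hUG _ ⟨y, hy⟩ => ⟨y, hy, hUG hy⟩
    | succ k ih =>
      intro U hUG hU hne
      set W := U ∩ excursions t δ k
      have hW : IsOpen W := hU.inter (hX.isOpen_excursions t δ k)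
      obtain ⟨w, hw⟩ : W.Nonempty := ih U hUG hU hne
      have hball : IsOpen (Metric.ball t (δ / 2)) := Metric.isOpen_ball
      obtain ⟨b, hbt, hb⟩ := mem_closure_iff.1
        (hcon W hW w (subset_beyond hw) (left_mem_arc t w)) _ hball
        (Metric.mem_ball_self (half_pos hδ))
      -- The arc `tb` has met `W` before coming back near `t`; it can be continued into `W`.
      have hV : IsOpen (beyond t W ∩ Metric.ball t (δ / 2)) := (hX.isOpen_beyond hW).inter hball
      obtain ⟨v, hvb, hvW⟩ := hb
      obtain ⟨y, hyW, hy⟩ := mem_closure_iff.1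
        (hcon _ hV b (subset_beyond ⟨⟨v, hvb, hvW⟩, hbt⟩) hvb) W hW hvW
      refine ⟨y, hyW.1, hUG hyW.1, ?_⟩
      exact beyond_mono (inter_subset_inter_left _ (beyond_mono inter_subset_right)) hy
  have hdense' : ∀ k, Dense (excursions t δ k ∪ (closure G)ᶜ) := by
    intro k
    refine dense_iff_inter_open.2 fun U hU hne => ?_
    rcases (U ∩ G).eq_empty_or_nonempty with h | h
    · obtain ⟨y, hy⟩ := hne
      exact ⟨y, hy, Or.inr fun hyG => by
        obtain ⟨z, hz⟩ := mem_closure_iff.1 hyG U hU hy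
        exact notMem_empty z (h ▸ hz)⟩
    · obtain ⟨y, hy, hyk⟩ := hdense k (U ∩ G) inter_subset_right (hU.inter hG) h
      exact ⟨y, hy.1, Or.inl hyk⟩
  obtain ⟨y, hyG, hy⟩ := (dense_iInter_of_isOpen_nat (fun k =>
    (hX.isOpen_excursions t δ k).union isClosed_closure.isOpen_compl) hdense').inter_open_nonempty
    G hG ⟨x, hδx⟩
  have hmem : y ∈ ⋂ k, excursions t δ k := mem_iInter.2 fun k =>
    (mem_iInter.1 hy k).resolve_right fun h => h (subset_closure hyG)
  rw [hX.iInter_excursions t hδ] at hmem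
  exact hmem

end Oscillation

/-! ### Fans of homogeneity degree three -/

section DegreeThree

variable {X : Type*} [MetricSpace X] {t b c e x y : X}

/-- In a fan of homogeneity degree `3`, arcs from the top that pass near an endpoint `e` end
near `e`. -/
theorem IsFan.eq_of_endpoint_mem_upperLimit (hX : IsFan X) (ht : t ∈ ramificationPoints X)
    (hdeg : homogeneityDegree X = 3) (he : e ∈ endpoints X) (hx : e ∈ upperLimit t x) : x = e := by
  have hD := hX.1
  by_contra hxe
  obtain ⟨het, hmax⟩ := (hX.mem_endpoints_iff ht).1 he
  have hext : e ∉ arc t x := fun h => hxe (hmax x h)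
  obtain ⟨c, hce, hcx, hne, hct⟩ := hD.exists_mem_arc_inter hext
  have hc := hX.mem_ordinaryPoints ht hce hct hne
  have hec : e ∈ upperLimit t c := hD.mem_upperLimit_of_mem_arc hx hcx
  -- By homogeneity, every leg is accumulated on by arcs that have passed near its endpoint.
  have hall : ∀ e' ∈ endpoints X, ∀ c' ∈ arc t e', c' ≠ t → c' ≠ e' → e' ∈ upperLimit t c' := by
    intro e' he' c' hc' hc't hc'e
    obtain ⟨h, rfl⟩ := (hX.exists_homeomorph ht hdeg).2 c hc c'
      (hX.mem_ordinaryPoints ht hc' hc't hc'e)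
    have heq : h e = e' := hX.endpoint_eq_of_mem ht ((map_mem_endpoints_iff h).2 he) he' hc't
      (hX.image_arc_top ht h e ▸ mem_image_of_mem h hce) hc'
    exact heq ▸ hX.map_mem_upperLimit ht h hec
  have hall' : ∀ e' ∈ endpoints X, ∀ c' ∈ arc t e', e' ∈ upperLimit t c' := fun e' he' =>
    hD.arc_subset_of_interior_subset ((hX.mem_endpoints_iff ht).1 he').1.symm
      (isClosed_setOf_mem_upperLimit t e') (hall e' he')
  obtain ⟨U, hU, y, hyU, hy⟩ := hD.exists_not_arc_subset_closure_beyond het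
  apply hy
  rcases eq_or_ne y t with rfl | hyt
  · rw [arc_self]
    exact singleton_subset_iff.2 (subset_closure hyU)
  obtain ⟨e', he', hye'⟩ := hX.exists_endpoint ht hyt
  intro c' hc'
  have := hall' e' he' c' (hD.arc_subset_arc_left hye' hc') _ (hD.isOpen_beyond hU)
    (hD.mem_beyond_of_mem_arc hyU hye')
  rwa [hD.beyond_beyond] at this

theorem IsFan.map_mem_smoothnessSet (hX : IsFan X) (ht : t ∈ ramificationPoints X) (h : X ≃ₜ X)
    (hy : y ∈ smoothnessSet t) : h y ∈ smoothnessSet t := by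
  rw [hX.1.mem_smoothnessSet_iff] at hy ⊢
  intro b hb
  have := hX.map_mem_upperLimit ht h.symm hb
  rw [h.symm_apply_apply] at this
  rw [← hX.image_arc_top ht h]
  exact ⟨_, hy this, h.apply_symm_apply b⟩

theorem IsFan.notMem_smoothnessSet_of_mem_ordinaryPoints (hX : IsFan X)
    (ht : t ∈ ramificationPoints X) (hdeg : homogeneityDegree X = 3) (hns : ¬ IsSmooth X)
    (hc : c ∈ ordinaryPoints t) : c ∉ smoothnessSet t := by
  have hD := hX.1
  intro hcS
  refine hns ⟨t, fun y => by_contra fun hy => ?_⟩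
  have hy' : ¬ upperLimit t y ⊆ arc t y := fun h => hy (hD.mem_smoothnessSet_iff.2 h)
  obtain ⟨b, hb, hby⟩ := not_subset.1 hy'
  obtain ⟨d, hdt, hdy, hdb, hdne⟩ := hD.exists_mem_arc_inter hby
  obtain ⟨h, rfl⟩ := (hX.exists_homeomorph ht hdeg).2 c hc d
    (hX.mem_ordinaryPoints ht hdt hdne hdb)
  have hbd := hD.mem_smoothnessSet_iff.1 (hX.map_mem_smoothnessSet ht h hcS)
    (hD.mem_upperLimit_of_mem_arc hb hdy)
  exact hdb (hD.mem_arc_antisymm hdt hbd)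

theorem IsFan.endpoints_subset_smoothnessSet (hX : IsFan X) (ht : t ∈ ramificationPoints X)
    (hdeg : homogeneityDegree X = 3) (hns : ¬ IsSmooth X) :
    endpoints X ⊆ smoothnessSet t := by
  intro e he
  have het := ((hX.mem_endpoints_iff ht).1 he).1
  obtain ⟨y, hyt, hy⟩ := (hX.1.dense_smoothnessSet t).inter_open_nonempty {t}ᶜ
    isOpen_compl_singleton ⟨e, het⟩
  have hyE : y ∈ endpoints X := by_contra fun hyE =>
    hX.notMem_smoothnessSet_of_mem_ordinaryPoints ht hdeg hns ⟨hyt, hyE⟩ hy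
  obtain ⟨h, rfl⟩ := (hX.exists_homeomorph ht hdeg).1 y hyE e he
  exact hX.map_mem_smoothnessSet ht h hy

theorem IsFan.dense_endpoints (hX : IsFan X) (ht : t ∈ ramificationPoints X)
    (hdeg : homogeneityDegree X = 3) (hns : ¬ IsSmooth X) : Dense (endpoints X) := by
  have : ConnectedSpace X := connectedSpace_iff_univ.2 hX.1.isSubcontinuum_univ.2
  obtain ⟨e, he⟩ := hX.endpoints_nonempty ht
  have : Nontrivial X := ⟨e, t, ((hX.mem_endpoints_iff ht).1 he).1⟩
  have hd : Dense (smoothnessSet t ∩ {t}ᶜ) :=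
    (hX.1.dense_smoothnessSet t).inter_of_isOpen_right (dense_compl_singleton t)
      isOpen_compl_singleton
  refine hd.mono fun y hy => by_contra fun hyE => ?_
  exact hX.notMem_smoothnessSet_of_mem_ordinaryPoints ht hdeg hns ⟨hy.2, hyE⟩ hy.1

/-- If `X` were not smooth at `t` with respect to `t`, then by homogeneity arcs ending near `t`
would pass near every ordinary point, hence near an endpoint. -/
theorem IsFan.top_mem_smoothnessSet (hX : IsFan X) (ht : t ∈ ramificationPoints X)
    (hdeg : homogeneityDegree X = 3) : t ∈ smoothnessSet t := by
  have hD := hX.1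
  rw [hD.mem_smoothnessSet_iff, arc_self]
  intro b hb
  by_contra hbt
  obtain ⟨c, hc, hct, hcb⟩ := hD.exists_mem_arc_ne (Ne.symm hbt)
  have hcL := hD.arc_subset_upperLimit hb hc
  have hO : ordinaryPoints t ⊆ upperLimit t t := by
    intro c' hc'
    obtain ⟨h, rfl⟩ := (hX.exists_homeomorph ht hdeg).2 c (hX.mem_ordinaryPoints ht hc hct hcb) c'
      hc'
    have := hX.map_mem_upperLimit ht h hcL
    rwa [hX.map_top ht] at this
  obtain ⟨e, he⟩ := hX.endpoints_nonempty ht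
  have het := ((hX.mem_endpoints_iff ht).1 he).1
  have heL : arc t e ⊆ upperLimit t t :=
    hD.arc_subset_of_interior_subset het.symm (isClosed_upperLimit t t) fun z hz hzt hze =>
      hO (hX.mem_ordinaryPoints ht hz hzt hze)
  exact het (hX.eq_of_endpoint_mem_upperLimit ht hdeg he (heL (right_mem_arc _ _))).symm

end DegreeThree

end FanTheory

theorem theorem5p3 {X : Type*} [MetricSpace X] (hX : FanTheory.IsFan X)
    (hns : ¬ FanTheory.IsSmooth X) (hdeg : FanTheory.homogeneityDegree X = 3)
    (t : X) (ht : t ∈ FanTheory.ramificationPoints X) :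
    (∀ e ∈ FanTheory.endpoints X, FanTheory.IsColocallyConnectedAt e) ∧
      Dense (FanTheory.endpoints X) ∧
      FanTheory.smoothnessSet t = FanTheory.endpoints X ∪ {t} := by
  have hD := hX.1
  refine ⟨fun e he => ?_, hX.dense_endpoints ht hdeg hns, ?_⟩
  · exact hD.isColocallyConnectedAt ((hX.mem_endpoints_iff ht).1 he).1 fun x hx =>
      hX.eq_of_endpoint_mem_upperLimit ht hdeg he hx
  · refine Subset.antisymm (fun y hy => ?_) (union_subset
      (hX.endpoints_subset_smoothnessSet ht hdeg hns)
      (singleton_subset_iff.2 (hX.top_mem_smoothnessSet ht hdeg)))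
    by_contra hyE
    rw [mem_union, not_or] at hyE
    exact hX.notMem_smoothnessSet_of_mem_ordinaryPoints ht hdeg hns ⟨hyE.2, hyE.1⟩ hy
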